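/- Let $G=(U\cup W,E)$ be a finite bipartite graph and let $\lambda,\mu>0$. For $S\subseteq E$ let $\mathrm{rk}_2(S)$ be the rank over $\mathbb F_2$ of the bipartite ($U\times W$) adjacency matrix of $(U\cup W,S)$, and let $\pi$ be the distribution on the subsets of $E$ with $\pi(S)\propto\lambda^{\mathrm{rk}_2(S)}\mu^{|S|}$. The single bond flip chain on the subsets of $E$ moves from $X_t$ as follows: pick $e\in E$ uniformly at random, let $S=X_t\oplus\{e\}$, set $X_{t+1}=S$ with probability $\frac12\min\{1,\lambda^{\mathrm{rk}_2(S)-\mathrm{rk}_2(X_t)}\mu^{|S|-|X_t|}\}$, and $X_{t+1}=X_t$ otherwise (if $E=\emptyset$, the chain stays at its only state). With $P$ its transition matrix, its mixing time is $$\tau(\varepsilon)=\max_{H\subseteq E}\min\{t\ge 0:\|P^t(H,\cdot)-\pi\|_{TV}\le\varepsilon\}.$$ Theorem. For trees $G$ on $n$ vertices, $$\tau(\varepsilon)=O\left(n^{3+|\log_2\lambda|}\,\bigl(|\log\lambda|+|\log\mu|+\log(1/\varepsilon)\bigr)\right)$$ in the following sense. (a) For every $\varepsilon_0\in(0,1)$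 there is a constant $C$, depending only on $\varepsilon_0$, such that for all $\lambda,\mu>0$, all $n$, all trees $G$ on $n$ vertices and all $0<\varepsilon\le\varepsilon_0$, the mixing time $\tau(\varepsilon)$ is finite and at most $C\,n^{3+|\log_2\lambda|}(|\log\lambda|+|\log\mu|+\log(1/\varepsilon))$. (b) For all fixed $\lambda,\mu>0$ with $(\lambda,\mu)\neq(1,1)$ there is a constant $C$, depending only on $\lambda$ and $\mu$, such that the same bound holds for all $n$, all trees $G$ on $n$ vertices and all $0<\varepsilon<1$. -/

import Mathlib

/-! ### Finite Markov chains: total variation distance and mixing time -/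

/-- The total variation distance `(1/2) ∑ₓ |ν x - ν' x|` of two distributions on a finite set. -/
noncomputable def tvDist {Ω : Type*} [Fintype Ω] (ν ν' : Ω → ℝ) : ℝ :=
  (1 / 2) * ∑ x, |ν x - ν' x|

/-- The mixing time from the initial state `x`: the least `t` such that the distribution
`P ^ t (x, ·)` is within total variation distance `ε` of `π` (and `⊤` if there is no such `t`). -/
noncomputable def mixingTimeFrom {Ω : Type*} [Fintype Ω] [DecidableEq Ω]
    (P : Matrix Ω Ω ℝ) (π : Ω → ℝ) (ε : ℝ) (x : Ω) : ℕ∞ :=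
  ⨅ (t : ℕ) (_ : tvDist (fun y => (P ^ t) x y) π ≤ ε), (t : ℕ∞)

/-- The mixing time of the chain: the maximum over all initial states. -/
noncomputable def mixingTime {Ω : Type*} [Fintype Ω] [DecidableEq Ω]
    (P : Matrix Ω Ω ℝ) (π : Ω → ℝ) (ε : ℝ) : ℕ∞ :=
  ⨆ x, mixingTimeFrom P π ε x

/-! ### Rank weighted subgraphs and the single bond flip chain

Throughout, `G` is a finite graph with bipartition `U`, `W`, and a state is a set `S` of edges
of `G`, that is, an element of `Finset G.edgeSet`. -/

namespace RWS

open scoped Classical in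
/-- The bipartite adjacency matrix over `𝔽₂` of the subgraph with edge set `S`: rows are indexed
by `U`, columns by `W`. -/
noncomputable def biadjMatrix {V : Type*} {G : SimpleGraph V} (U W : Set V)
    (S : Finset G.edgeSet) : Matrix U W (ZMod 2) :=
  Matrix.of fun u w => if ∃ e ∈ S, (e : Sym2 V) = s(u.1, w.1) then 1 else 0

open scoped Classical in
/-- `rk₂ S`: the rank over `𝔽₂` of the bipartite adjacency matrix of `S`. -/
noncomputable def rk₂ {V : Type*} [Fintype V] {G : SimpleGraph V} (U W : Set V)
    (S : Finset G.edgeSet) : ℕ :=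
  (biadjMatrix U W S).rank

/-- The weight `lam ^ rk₂ S * mu ^ |S|` of an edge set `S`. -/
noncomputable def weight {V : Type*} [Fintype V] {G : SimpleGraph V} (U W : Set V)
    (lam mu : ℝ) (S : Finset G.edgeSet) : ℝ :=
  lam ^ rk₂ U W S * mu ^ S.card

open scoped Classical in
/-- The target distribution: the probability of `S` is proportional to its weight. -/
noncomputable def dist {V : Type*} [Fintype V] (G : SimpleGraph V) (U W : Set V)
    (lam mu : ℝ) (S : Finset G.edgeSet) : ℝ :=
  weight U W lam mu S / ∑ T : Finset G.edgeSet, weight U W lam mu T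

open scoped Classical in
/-- The probability that, from the state `X`, the edge `e` is picked (uniformly among all edges)
and the move to `X ⊕ {e}` is accepted. -/
noncomputable def flipProb {V : Type*} [Fintype V] {G : SimpleGraph V} (U W : Set V)
    (lam mu : ℝ) (X : Finset G.edgeSet) (e : G.edgeSet) : ℝ :=
  (1 / (Fintype.card G.edgeSet : ℝ)) *
    ((1 / 2) * min 1
      (lam ^ ((rk₂ U W (symmDiff X {e}) : ℤ) - (rk₂ U W X : ℤ)) *
        mu ^ (((symmDiff X {e}).card : ℤ) - (X.card : ℤ))))

open scoped Classical in
/-- The transition matrix of the single bond flip chain: from `X` pick a uniformly random edge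
`e`, move to `X ⊕ {e}` with the acceptance probability above, and otherwise stay at `X`. (If there
are no edges, the chain stays at its only state.) -/
noncomputable def transition {V : Type*} [Fintype V] (G : SimpleGraph V) (U W : Set V)
    (lam mu : ℝ) : Matrix (Finset G.edgeSet) (Finset G.edgeSet) ℝ :=
  Matrix.of fun X Y =>
    (∑ e : G.edgeSet, if symmDiff X {e} = Y then flipProb U W lam mu X e else 0) +
      if X = Y then 1 - ∑ e : G.edgeSet, flipProb U W lam mu X e else 0

open scoped Classical in
/-- The mixing time `τ(ε)` of the single bond flip chain. -/
noncomputable def bondFlipMixingTime {V : Type*} [Fintype V] (G : SimpleGraph V) (U W : Set V)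
    (lam mu ε : ℝ) : ℕ∞ :=
  mixingTime (transition G U W lam mu) (dist G U W lam mu) ε

end RWS

/-!
The proof bounds the spectral gap by canonical paths. Fix an order `e₁, …, eₘ` of the edges of the
tree, and move from a state `I` to a state `F` by replacing `I` by `F` on `e₁`, then on `e₂`, and so
on. With `K = {e₁, …, eₜ}`, the path is then at `H = (F ∩ K) ∪ (I \ K)`, and `H` together with
`H' = (I ∩ K) ∪ (F \ K)` determines `I` and `F`. So if `π I * π F ≤ Λ * (π H * π H')` always holds,
each move carries little flow, and the chain satisfies a Poincaré inequality with constant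
`4 * m ^ 2 * Λ` (`piVariance_le_of_splice`, `RWS.dirichletForm_transition`). As the chain is lazy
and reversible, the variance of the density of its law decays at the corresponding rate, which
bounds the mixing time (`IsLazyReversible.exists_mixingTime_eq`).

It remains to take `Λ = n ^ |log₂ lam|`. Since `|H| + |H'| = |I| + |F|`, only the ranks matter. If
`K` and its complement share `k` vertices, `rk₂ H + rk₂ H'` and `rk₂ I + rk₂ F` differ by at most
`k` (`RWS.rk₂_add_le_splice`). To see this, let `d(A, B) = rk₂ A + rk₂ B - rk₂ (A ∪ B)` for `A`
inside and `B` outside `K`, and let `a` and `b` be the losses of rank of `A` and `B` when the shared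
vertices are removed. Then `max 0 (a + b - k) ≤ d(A, B) ≤ min a b`, and the claim follows by
combining these bounds for the four pairs. The upper bound on `d` is where the graph being a forest
enters: ranks of vertex-disjoint parts of an edge set add up to at most its rank
(`RWS.rk₂_add_le_of_vertexDisjoint`), which is seen by removing the neighbour of a leaf.

Finally, a tree has an order of its edges in which every initial segment shares at most `log₂ n`
vertices with its complement (`SimpleGraph.IsAcyclic.exists_isNarrowOrder`). It arises by deleting an
edge at a root and ordering the two components recursively, the larger one first. The exponent of
`n` in the final bound is `2` from the number of edges and the length of the paths, `1` from
`log (1 / min π) = O(n)`, and `|log₂ lam|` from `Λ`.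
-/

/-! ### The rank over `𝔽₂` of edge sets of a tree -/

namespace RWS

open scoped Classical in
/-- The edges of `S` that meet no vertex of `X`. -/
noncomputable def avoid {V : Type*} {G : SimpleGraph V} (X : Finset V)
    (S : Finset G.edgeSet) : Finset G.edgeSet :=
  S.filter fun e => ∀ v ∈ X, v ∉ (e : Sym2 V)

section Rank

variable {V : Type*} {G : SimpleGraph V}

lemma mem_avoid {X : Finset V} {S : Finset G.edgeSet} {e : G.edgeSet} :
    e ∈ avoid X S ↔ e ∈ S ∧ ∀ v ∈ X, v ∉ (e : Sym2 V) := by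
  simp [avoid]

lemma avoid_subset (X : Finset V) (S : Finset G.edgeSet) : avoid X S ⊆ S := by
  intro e he
  exact (mem_avoid.1 he).1

lemma avoid_mono (X : Finset V) {S T : Finset G.edgeSet} (h : S ⊆ T) : avoid X S ⊆ avoid X T := by
  intro e he
  rw [mem_avoid] at he ⊢
  exact ⟨h he.1, he.2⟩

lemma biadjMatrix_swap (U W : Set V) (S : Finset G.edgeSet) :
    biadjMatrix W U S = (biadjMatrix U W S).transpose := by
  ext u w
  simp only [biadjMatrix, Matrix.of_apply, Matrix.transpose_apply]
  rw [Sym2.eq_swap]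

open scoped Classical in
lemma biadjMatrix_union (U W : Set V) {A B : Finset G.edgeSet} (h : Disjoint A B) :
    biadjMatrix U W (A ∪ B) = biadjMatrix U W A + biadjMatrix U W B := by
  ext u w
  have key : ¬ ((∃ e ∈ A, (e : Sym2 V) = s(u.1, w.1)) ∧ ∃ e ∈ B, (e : Sym2 V) = s(u.1, w.1)) := by
    rintro ⟨⟨e, he, h1⟩, ⟨f, hf, h2⟩⟩
    have : e = f := Subtype.ext (h1.trans h2.symm)
    exact Finset.disjoint_left.1 h he (this ▸ hf)
  have hor : (∃ e ∈ A ∪ B, (e : Sym2 V) = s(u.1, w.1)) ↔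
      (∃ e ∈ A, (e : Sym2 V) = s(u.1, w.1)) ∨ ∃ e ∈ B, (e : Sym2 V) = s(u.1, w.1) := by
    simp only [Finset.mem_union, or_and_right, exists_or]
  simp only [biadjMatrix, Matrix.of_apply, Matrix.add_apply, hor]
  by_cases h1 : ∃ e ∈ A, (e : Sym2 V) = s(u.1, w.1) <;>
    by_cases h2 : ∃ e ∈ B, (e : Sym2 V) = s(u.1, w.1) <;> simp_all

variable [Fintype V]

lemma rk₂_swap (U W : Set V) (S : Finset G.edgeSet) : rk₂ W U S = rk₂ U W S := by
  classical
  rw [rk₂, biadjMatrix_swap, rk₂]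
  exact Matrix.rank_transpose _

lemma rk₂_empty (U W : Set V) : rk₂ U W (∅ : Finset G.edgeSet) = 0 := by
  classical
  have : biadjMatrix U W (∅ : Finset G.edgeSet) = 0 := by
    ext u w; simp [biadjMatrix]
  rw [rk₂, this, Matrix.rank_zero]

lemma rk₂_le_card (U W : Set V) (S : Finset G.edgeSet) : rk₂ U W S ≤ Fintype.card V := by
  classical
  exact (Matrix.rank_le_card_width _).trans (Fintype.card_subtype_le _)

lemma _root_.Matrix.rank_add_le {K m n : Type*} [Field K] [Fintype m] [Fintype n]
    (A B : Matrix m n K) : (A + B).rank ≤ A.rank + B.rank := by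
  classical
  unfold Matrix.rank
  refine le_trans (Submodule.finrank_mono ?_)
    (Submodule.finrank_add_le_finrank_add_finrank _ _)
  rintro _ ⟨x, rfl⟩
  rw [Matrix.mulVecLin_add]
  exact Submodule.add_mem_sup ⟨x, rfl⟩ ⟨x, rfl⟩

open scoped Classical in
lemma rk₂_union_le (U W : Set V) {A B : Finset G.edgeSet} (h : Disjoint A B) :
    rk₂ U W (A ∪ B) ≤ rk₂ U W A + rk₂ U W B := by
  rw [rk₂, biadjMatrix_union U W h]
  exact Matrix.rank_add_le _ _

open scoped Classical in
/-- The edges at one vertex occupy a single row or column of the matrix. -/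
lemma rk₂_star_le {U W : Set V} (hUW : Disjoint U W) {v : V} {S : Finset G.edgeSet}
    (hS : ∀ e ∈ S, v ∈ (e : Sym2 V)) : rk₂ U W S ≤ 1 := by
  wlog hv : v ∉ W generalizing U W
  · rw [← rk₂_swap]
    exact this hUW.symm fun h => Set.disjoint_left.1 hUW h (not_not.1 hv)
  refine (Matrix.rank_le_card_of_support_subset _ (Finset.univ.filter fun u : U => u.1 = v) ?_).trans
    (Finset.card_le_one.2 ?_)
  · intro u hu
    by_contra hne
    apply hu
    ext w
    change (if _ then _ else _) = _
    rw [if_neg, Pi.zero_apply]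
    rintro ⟨e, he, h⟩
    have := hS e he
    rw [h, Sym2.mem_iff] at this
    rcases this with h' | h'
    · exact hne (by simp [h'])
    · exact hv (h' ▸ w.2)
  · intro a ha b hb
    simp only [Finset.mem_filter, Finset.mem_univ, true_and] at ha hb
    exact Subtype.ext (ha.trans hb.symm)

open scoped Classical in
lemma rk₂_le_avoid_singleton {U W : Set V} (hUW : Disjoint U W) (v : V) (S : Finset G.edgeSet) :
    rk₂ U W S ≤ rk₂ U W (avoid {v} S) + 1 := by
  have hd : Disjoint (avoid {v} S) (S \ avoid {v} S) := Finset.disjoint_sdiff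
  have := rk₂_union_le U W hd
  rw [Finset.union_sdiff_of_subset (avoid_subset _ _)] at this
  refine this.trans (Nat.add_le_add_left (rk₂_star_le hUW (v := v) ?_) _)
  intro e he
  rw [Finset.mem_sdiff, mem_avoid] at he
  by_contra hv
  exact he.2 ⟨he.1, by simpa using hv⟩

lemma rk₂_le_avoid {U W : Set V} (hUW : Disjoint U W) (X : Finset V) (S : Finset G.edgeSet) :
    rk₂ U W S ≤ rk₂ U W (avoid X S) + X.card := by
  classical
  induction X using Finset.induction_on with
  | empty =>
    have : avoid ∅ S = S := by ext e; simp [mem_avoid]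
    simp [this]
  | insert v X hv ih =>
    have h1 : avoid (insert v X) S = avoid {v} (avoid X S) := by
      ext e; simp [mem_avoid]; tauto
    have := rk₂_le_avoid_singleton hUW v (avoid X S)
    rw [h1, Finset.card_insert_of_notMem hv]
    omega

/-- If `l` is a leaf of `S` with neighbour `v`, then its row is a unit vector, and clearing the
column of `v` loses the coordinate of `l` from the range. -/
lemma rk₂_avoid_lt_of_leaf {U W : Set V} (hG : G.IsBipartiteWith U W) {l v : V}
    {S : Finset G.edgeSet} (hlv : ∃ e ∈ S, (e : Sym2 V) = s(l, v))
    (hl : ∀ e ∈ S, l ∈ (e : Sym2 V) → (e : Sym2 V) = s(l, v)) :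
    rk₂ U W (avoid {v} S) < rk₂ U W S := by
  classical
  have hadj : G.Adj l v := by
    obtain ⟨e, -, he⟩ := hlv
    exact SimpleGraph.mem_edgeSet _ |>.1 (he ▸ e.2)
  wlog hU : l ∈ U ∧ v ∈ W generalizing U W
  · rw [← rk₂_swap U W, ← rk₂_swap U W]
    exact this hG.symm ((hG.mem_of_adj hadj).resolve_left hU).symm.symm
  obtain ⟨hlU, hvW⟩ := hU
  rw [rk₂, rk₂]
  unfold Matrix.rank
  apply Submodule.finrank_lt_finrank_of_lt
  set M := biadjMatrix U W S with hM
  set N := biadjMatrix U W (avoid {v} S) with hN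
  have hNM : ∀ u w, N u w = if w.1 = v then 0 else M u w := by
    intro u w
    simp only [hN, hM, biadjMatrix, Matrix.of_apply]
    by_cases hw : w.1 = v
    · rw [if_pos hw, if_neg]
      rintro ⟨e, he, h⟩
      apply (mem_avoid.1 he).2 v (by simp)
      rw [h, ← hw]; simp
    · rw [if_neg hw]
      congr 1
      apply propext
      constructor
      · rintro ⟨e, he, h⟩
        exact ⟨e, avoid_subset _ _ he, h⟩
      · rintro ⟨e, he, h⟩
        refine ⟨e, mem_avoid.2 ⟨he, ?_⟩, h⟩
        intro x hx
        rw [Finset.mem_singleton] at hx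
        subst hx
        rw [h, Sym2.mem_iff]
        rintro (h' | h')
        · exact Set.disjoint_left.1 hG.disjoint (h' ▸ u.2) hvW
        · exact hw h'.symm
  have hMl : ∀ w : W, M ⟨l, hlU⟩ w = if w.1 = v then 1 else 0 := by
    intro w
    simp only [hM, biadjMatrix, Matrix.of_apply]
    congr 1
    apply propext
    constructor
    · rintro ⟨e, he, h⟩
      have := hl e he (by rw [h]; simp)
      rw [h, Sym2.eq_iff] at this
      rcases this with h' | h'
      · exact h'.2
      · exact absurd h'.1 hadj.ne
    · rintro h
      rw [h]; exact hlv
  refine lt_of_le_of_ne ?_ fun heq => ?_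
  · rintro _ ⟨x, rfl⟩
    refine ⟨fun w => if w.1 = v then 0 else x w, ?_⟩
    ext u
    simp only [Matrix.mulVecLin_apply, Matrix.mulVec, dotProduct]
    refine Finset.sum_congr rfl fun w _ => ?_
    rw [hNM]
    split_ifs <;> simp
  · have hmem : M.mulVecLin (Pi.single ⟨v, hvW⟩ 1) ∈ LinearMap.range N.mulVecLin :=
      heq ▸ ⟨_, rfl⟩
    obtain ⟨x, hx⟩ := hmem
    have h1 := congrFun hx ⟨l, hlU⟩
    have h2 : N.mulVecLin x ⟨l, hlU⟩ = 0 := by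
      simp only [Matrix.mulVecLin_apply, Matrix.mulVec, dotProduct]
      refine Finset.sum_eq_zero fun w _ => ?_
      rw [hNM, hMl]
      split_ifs <;> simp
    rw [h2] at h1
    simp [hMl] at h1

/-- Every nonempty set of edges of a tree has a leaf: an endpoint at maximal distance from a fixed
root, since its only neighbour not farther from the root is the next vertex on the path there. -/
lemma exists_leaf (hG : G.IsTree) {S : Finset G.edgeSet} (hS : S.Nonempty) :
    ∃ l v, (∃ e ∈ S, (e : Sym2 V) = s(l, v)) ∧
      ∀ e ∈ S, l ∈ (e : Sym2 V) → (e : Sym2 V) = s(l, v) := by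
  classical
  obtain ⟨r⟩ := hG.connected.nonempty
  choose p hp hp' using hG.existsUnique_path r
  obtain ⟨l, hl, hmax⟩ := Finset.exists_max_image
    (Finset.univ.filter fun v : V => ∃ e ∈ S, v ∈ (e : Sym2 V)) (fun v => (p v).length) (by
      obtain ⟨e, he⟩ := hS
      obtain ⟨v, hv⟩ : ∃ v, v ∈ (e : Sym2 V) := ⟨_, Sym2.out_fst_mem _⟩
      exact ⟨v, by simpa using ⟨e.1, ⟨e.2, he⟩, hv⟩⟩)
  simp only [Finset.mem_filter, Finset.mem_univ, true_and] at hl hmax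
  have key : ∀ e ∈ S, l ∈ (e : Sym2 V) → (e : Sym2 V) = s(l, (p l).penultimate) := by
    intro e he hle
    obtain ⟨u, hu⟩ := hle
    have hadj : G.Adj l u := SimpleGraph.mem_edgeSet _ |>.1 (hu ▸ e.2)
    have hsupp : u ∈ (p l).support := by
      by_contra hn
      have h1 := hp' u _ ((hp l).concat hn hadj)
      have h2 := hmax u ⟨e, he, by rw [hu]; simp⟩
      simp only [← h1, SimpleGraph.Walk.length_concat] at h2
      omega
    rw [hu, ← hG.isAcyclic.eq_penultimate_of_adj_end (hp l) hadj hsupp]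
  obtain ⟨e, he, hle⟩ := hl
  exact ⟨l, _, ⟨e, he, key e he hle⟩, key⟩

/-- In a tree, vertex-disjoint edge sets inside `S` have ranks adding up to at most that of `S`.
In particular the rank is monotone, which fails over `𝔽₂` for general bipartite graphs. -/
lemma rk₂_add_le_of_vertexDisjoint {U W : Set V} (hG : G.IsTree) (hUW : G.IsBipartiteWith U W)
    {A B S : Finset G.edgeSet} (hA : A ⊆ S) (hB : B ⊆ S)
    (hAB : ∀ e ∈ A, ∀ f ∈ B, ∀ v, v ∈ (e : Sym2 V) → v ∉ (f : Sym2 V)) :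
    rk₂ U W A + rk₂ U W B ≤ rk₂ U W S := by
  classical
  induction hn : S.card using Nat.strong_induction_on generalizing A B S with
  | _ n ih =>
  rcases S.eq_empty_or_nonempty with rfl | hS
  · rw [Finset.subset_empty.1 hA, Finset.subset_empty.1 hB]
    simp [rk₂_empty]
  obtain ⟨l, v, hlv, hl⟩ := exists_leaf hG hS
  have hlt := rk₂_avoid_lt_of_leaf hUW hlv hl
  have hcard : (avoid {v} S).card < n := by
    rw [← hn]
    apply Finset.card_lt_card
    rw [Finset.ssubset_iff_subset_ne]
    refine ⟨avoid_subset _ _, fun h => ?_⟩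
    obtain ⟨e, he, hev⟩ := hlv
    rw [← h] at he
    exact (mem_avoid.1 he).2 v (by simp) (by rw [hev]; simp)
  have h := ih _ hcard (avoid_mono {v} hA) (avoid_mono {v} hB)
    (fun e he f hf => hAB e (avoid_subset _ _ he) f (avoid_subset _ _ hf)) rfl
  have hA1 := rk₂_le_avoid_singleton hUW.disjoint v A
  have hB1 := rk₂_le_avoid_singleton hUW.disjoint v B
  -- the vertex `v` meets at most one of the two sets, and the other one is unchanged
  have hor : avoid {v} A = A ∨ avoid {v} B = B := by
    by_contra! hne
    obtain ⟨e, he, hev⟩ : ∃ e ∈ A, v ∈ (e : Sym2 V) := by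
      by_contra! hno
      exact hne.1 (by ext e; simp only [mem_avoid, Finset.mem_singleton, forall_eq]; grind)
    exact hne.2 (by
      ext f; simp only [mem_avoid, Finset.mem_singleton, forall_eq]
      exact ⟨fun h => h.1, fun h => ⟨h, hAB e he f h v hev⟩⟩)
  rcases hor with h' | h' <;> rw [h'] at h <;> omega

/-- The set `I` with its part inside `K` replaced by the part of `F` inside `K`. -/
noncomputable def _root_.Finset.splice {α : Type*} [DecidableEq α] (K I F : Finset α) : Finset α :=
  (F ∩ K) ∪ (I \ K)

open scoped Classical in
lemma rk₂_add_le_splice {U W : Set V} (hG : G.IsTree) (hUW : G.IsBipartiteWith U W)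
    {K : Finset G.edgeSet} {X : Finset V}
    (hX : ∀ e ∈ K, ∀ f ∉ K, ∀ v, v ∈ (e : Sym2 V) → v ∈ (f : Sym2 V) → v ∈ X)
    (I F : Finset G.edgeSet) :
    rk₂ U W I + rk₂ U W F ≤ rk₂ U W (K.splice I F) + rk₂ U W (K.splice F I) + X.card := by
  -- Ranks of a set glued from a part `A` inside and a part `B` outside the cut.
  have up : ∀ A B : Finset G.edgeSet,
      rk₂ U W ((A ∩ K) ∪ (B \ K)) ≤ rk₂ U W (A ∩ K) + rk₂ U W (B \ K) := fun A B =>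
    rk₂_union_le U W (Finset.disjoint_left.2 fun e h1 h2 => by
      simp only [Finset.mem_inter, Finset.mem_sdiff] at h1 h2; exact h2.2 h1.2)
  have upX : ∀ A B : Finset G.edgeSet, rk₂ U W ((A ∩ K) ∪ (B \ K)) ≤
      rk₂ U W (avoid X (A ∩ K)) + rk₂ U W (avoid X (B \ K)) + X.card := by
    intro A B
    refine (rk₂_le_avoid hUW.disjoint X _).trans (Nat.add_le_add_right ?_ _)
    have : avoid X ((A ∩ K) ∪ (B \ K)) = avoid X (A ∩ K) ∪ avoid X (B \ K) := by
      ext e; simp only [mem_avoid, Finset.mem_union]; tauto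
    rw [this]
    refine rk₂_union_le U W (Finset.disjoint_left.2 fun e h1 h2 => ?_)
    simp only [mem_avoid, Finset.mem_inter, Finset.mem_sdiff] at h1 h2
    exact h2.1.2 h1.1.2
  have lo1 : ∀ A B : Finset G.edgeSet, rk₂ U W (A ∩ K) + rk₂ U W (avoid X (B \ K)) ≤
      rk₂ U W ((A ∩ K) ∪ (B \ K)) := by
    intro A B
    refine rk₂_add_le_of_vertexDisjoint hG hUW Finset.subset_union_left
      ((avoid_subset _ _).trans Finset.subset_union_right) ?_
    intro e he f hf v hv hv'
    simp only [mem_avoid, Finset.mem_inter, Finset.mem_sdiff] at he hf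
    exact hf.2 v (hX e he.2 f hf.1.2 v hv hv') hv'
  have lo2 : ∀ A B : Finset G.edgeSet, rk₂ U W (avoid X (A ∩ K)) + rk₂ U W (B \ K) ≤
      rk₂ U W ((A ∩ K) ∪ (B \ K)) := by
    intro A B
    refine rk₂_add_le_of_vertexDisjoint hG hUW
      ((avoid_subset _ _).trans Finset.subset_union_left) Finset.subset_union_right ?_
    intro e he f hf v hv hv'
    simp only [mem_avoid, Finset.mem_inter, Finset.mem_sdiff] at he hf
    exact he.2 v (hX e he.1.2 f hf.2 v hv hv') hv
  have hII : (I ∩ K) ∪ (I \ K) = I := by ext; simp; tauto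
  have hFF : (F ∩ K) ∪ (F \ K) = F := by ext; simp; tauto
  have a1 := up I I
  have a2 := up F F
  have a3 := upX I I
  have a4 := upX F F
  have b1 := lo1 F I
  have b2 := lo2 F I
  have b3 := lo1 I F
  have b4 := lo2 I F
  rw [hII] at a1 a3
  rw [hFF] at a2 a4
  unfold Finset.splice
  omega

end Rank

end RWS

/-! ### Edge orders of forests with small vertex boundary -/

namespace SimpleGraph

section Ordering

variable {V : Type*}

lemma Reachable.deleteEdges_or {F : SimpleGraph V} {r c v : V} (h : F.Reachable r v) :
    (F.deleteEdges {s(r, c)}).Reachable r v ∨ (F.deleteEdges {s(r, c)}).Reachable c v := by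
  obtain ⟨p⟩ := h.symm
  clear h
  induction p with
  | nil => exact Or.inl .rfl
  | @cons u w x hadj p ih =>
    by_cases he : s(w, u) = s(x, c)
    · rw [Sym2.eq_iff] at he
      rcases he with ⟨-, rfl⟩ | ⟨-, rfl⟩
      · exact Or.inr .rfl
      · exact Or.inl .rfl
    · have hadj' : (F.deleteEdges {s(x, c)}).Adj w u := by
        simp only [deleteEdges_adj, Set.mem_singleton_iff]
        exact ⟨hadj.symm, he⟩
      exact ih.imp (·.trans hadj'.reachable) (·.trans hadj'.reachable)

open scoped Classical in
/-- The vertices at which the edge list `l₁` is still open when `l₂` is yet to come: those met by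
`l₁` that are met by `l₂` or are the root `r`. -/
noncomputable def frontier [Fintype V] (r : V) (l₁ l₂ : List (Sym2 V)) : Finset V :=
  Finset.univ.filter fun v => (∃ e ∈ l₁, v ∈ e) ∧ (v = r ∨ ∃ e ∈ l₂, v ∈ e)

lemma mem_frontier [Fintype V] {r v : V} {l₁ l₂ : List (Sym2 V)} :
    v ∈ frontier r l₁ l₂ ↔ (∃ e ∈ l₁, v ∈ e) ∧ (v = r ∨ ∃ e ∈ l₂, v ∈ e) := by
  simp [frontier]

/-- The number of vertices of the component of `r`. -/
noncomputable def componentCard [Fintype V] (F : SimpleGraph V) (r : V) : ℕ :=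
  {v | F.Reachable r v}.ncard

lemma componentCard_pos [Fintype V] (F : SimpleGraph V) (r : V) : 0 < F.componentCard r :=
  (Set.ncard_pos (Set.toFinite _)).2 ⟨r, .rfl⟩

/-- `l` lists the edges of the component of `r`, and at each time the number of open vertices is
at most the binary logarithm of the size of the component. -/
structure IsNarrowOrder [Fintype V] (F : SimpleGraph V) (r : V) (l : List (Sym2 V)) : Prop where
  nodup : l.Nodup
  mem_iff : ∀ e, e ∈ l ↔ e ∈ F.edgeSet ∧ ∀ v ∈ e, F.Reachable r v
  card_le : ∀ l₁ l₂, l = l₁ ++ l₂ → 2 ^ (frontier r l₁ l₂).card ≤ F.componentCard r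

lemma pow_two_card_le_of_subset_insert [Fintype V] {n m : ℕ} {r : V} {A B : Finset V}
    (h : ∀ v ∈ A, v = r ∨ v ∈ B) (hB : 2 ^ B.card ≤ n) (hm : 2 * n ≤ m) : 2 ^ A.card ≤ m := by
  classical
  have h1 : A.card ≤ B.card + 1 := (Finset.card_le_card (fun v hv => by
    rcases h v hv with h | h <;> simp [h])).trans (Finset.card_insert_le r B)
  calc 2 ^ A.card ≤ 2 ^ (B.card + 1) := Nat.pow_le_pow_right (by norm_num) h1
    _ ≤ m := by rw [pow_succ]; omega

/-- In a forest, delete an edge `rc` at the root, and list the two resulting components with the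
larger one first: while the smaller one is listed, its own open vertices are accompanied by at most
the root of the larger one. -/
theorem IsAcyclic.exists_isNarrowOrder [Fintype V] {F : SimpleGraph V} (hF : F.IsAcyclic) (r : V) :
    ∃ l, F.IsNarrowOrder r l := by
  classical
  induction hn : F.edgeSet.ncard using Nat.strong_induction_on generalizing F r with
  | _ n ih =>
  by_cases hc : ∃ c, F.Adj r c
  swap
  · push Not at hc
    have hiso : ∀ v, F.Reachable r v → v = r := by
      rintro v ⟨p⟩
      cases p with
      | nil => rfl
      | cons h _ => exact absurd h (hc _)
    refine ⟨[], List.nodup_nil, fun e => ?_, fun l₁ l₂ h => ?_⟩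
    · induction e with | _ a b
      simp only [List.not_mem_nil, mem_edgeSet, Sym2.mem_iff, forall_eq_or_imp, forall_eq, false_iff]
      rintro ⟨hab, ha, hb⟩
      exact hab.ne ((hiso a ha).trans (hiso b hb).symm)
    · obtain ⟨rfl, rfl⟩ := List.append_eq_nil_iff.1 h.symm
      have : frontier r ([] : List (Sym2 V)) [] = ∅ := by ext; simp [mem_frontier]
      rw [this]; exact F.componentCard_pos r
  obtain ⟨c, hrc⟩ := hc
  set D := F.deleteEdges {s(r, c)} with hD
  have hDF : D ≤ F := deleteEdges_le _
  have hDa : D.IsAcyclic := hF.anti hDF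
  have hbr : ¬ D.Reachable r c := isBridge_iff.1 (isAcyclic_iff_forall_isBridge.1 hF hrc)
  have hlt : D.edgeSet.ncard < n := by
    rw [← hn]
    refine Set.ncard_lt_ncard ?_ (Set.toFinite _)
    refine (Set.ssubset_iff_of_subset (edgeSet_mono hDF)).2 ⟨s(r, c), hrc, ?_⟩
    simp [hD]
  obtain ⟨lB, hB⟩ := ih _ hlt hDa r rfl
  obtain ⟨lC, hC⟩ := ih _ hlt hDa c rfl
  have hcard : D.componentCard r + D.componentCard c = F.componentCard r := by
    unfold componentCard
    rw [← Set.ncard_union_eq _ (Set.toFinite _) (Set.toFinite _)]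
    · congr 1
      ext v
      constructor
      · rintro (h | h)
        · exact Reachable.mono hDF h
        · exact hrc.reachable.trans (Reachable.mono hDF h)
      · exact fun h => h.deleteEdges_or
    · exact Set.disjoint_left.2 fun v h1 h2 => hbr (Reachable.trans h1 (Reachable.symm h2))
  have rB : ∀ e ∈ lB, ∀ v ∈ e, D.Reachable r v := fun e he => ((hB.mem_iff e).1 he).2
  have rC : ∀ e ∈ lC, ∀ v ∈ e, D.Reachable c v := fun e he => ((hC.mem_iff e).1 he).2
  have hdisj : ∀ v, D.Reachable r v → D.Reachable c v → False := fun v h1 h2 =>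
    hbr (h1.trans h2.symm)
  have hmem : ∀ e, (e ∈ lB ∨ e = s(r, c) ∨ e ∈ lC) ↔
      e ∈ F.edgeSet ∧ ∀ v ∈ e, F.Reachable r v := by
    intro e
    rw [hB.mem_iff, hC.mem_iff]
    constructor
    · rintro (⟨h1, h2⟩ | rfl | ⟨h1, h2⟩)
      · exact ⟨edgeSet_mono hDF h1, fun v hv => (h2 v hv).mono hDF⟩
      · refine ⟨hrc, fun v hv => ?_⟩
        rcases Sym2.mem_iff.1 hv with rfl | rfl
        · exact .rfl
        · exact hrc.reachable
      · exact ⟨edgeSet_mono hDF h1, fun v hv => hrc.reachable.trans ((h2 v hv).mono hDF)⟩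
    · rintro ⟨h1, h2⟩
      by_cases he : e = s(r, c)
      · exact Or.inr (Or.inl he)
      have h3 : e ∈ D.edgeSet := by rw [hD, edgeSet_deleteEdges]; exact ⟨h1, he⟩
      induction e with | _ a b
      have hab : D.Adj a b := h3
      rcases (h2 a (by simp)).deleteEdges_or (c := c) with h | h
      · refine Or.inl ⟨h3, fun v hv => ?_⟩
        rcases Sym2.mem_iff.1 hv with rfl | rfl
        exacts [h, h.trans hab.reachable]
      · refine Or.inr (Or.inr ⟨h3, fun v hv => ?_⟩)
        rcases Sym2.mem_iff.1 hv with rfl | rfl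
        exacts [h, h.trans hab.reachable]
  have heB : s(r, c) ∉ lB := fun h => by
    have := ((hB.mem_iff _).1 h).1
    simp [hD] at this
  have heC : s(r, c) ∉ lC := fun h => by
    have := ((hC.mem_iff _).1 h).1
    simp [hD] at this
  have hBC : ∀ e ∈ lB, e ∉ lC := by
    intro e h1 h2
    induction e with | _ a b
    exact hdisj a (rB _ h1 a (by simp)) (rC _ h2 a (by simp))
  have hposB := D.componentCard_pos r
  have hposC := D.componentCard_pos c
  rcases le_total (D.componentCard r) (D.componentCard c) with hle | hle
  · refine ⟨lC ++ s(r, c) :: lB, ?_, fun e => ?_, fun l₁ l₂ h => ?_⟩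
    · rw [List.nodup_append, List.nodup_cons]
      refine ⟨hC.nodup, ⟨heB, hB.nodup⟩, fun e h1 f h2 hef => ?_⟩
      subst hef
      rcases List.mem_cons.1 h2 with rfl | h2
      exacts [heC h1, hBC e h2 h1]
    · rw [← hmem, List.mem_append, List.mem_cons]; tauto
    · rcases List.append_eq_append_iff.1 h with ⟨t, rfl, ht⟩ | ⟨t, hlC, rfl⟩
      · rcases List.cons_eq_append_iff.1 ht with ⟨rfl, rfl⟩ | ⟨t', rfl, hlB⟩
        · refine (hC.card_le lC [] (by simp)).trans' (Nat.pow_le_pow_right (by norm_num)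
            (Finset.card_le_card ?_)) |>.trans (by omega)
          intro v hv
          simp only [List.append_nil, mem_frontier, List.mem_cons, exists_eq_or_imp, Sym2.mem_iff] at hv ⊢
          obtain ⟨⟨e, he, hve⟩, hv2⟩ := hv
          refine ⟨⟨e, he, hve⟩, Or.inl ?_⟩
          have hcv := rC e he v hve
          rcases hv2 with rfl | (rfl | rfl) | ⟨f, hf, hvf⟩
          · exact (hbr hcv.symm).elim
          · exact (hbr hcv.symm).elim
          · rfl
          · exact (hdisj v (rB f hf v hvf) hcv).elim
        · refine pow_two_card_le_of_subset_insert (r := r) ?_ (hB.card_le t' l₂ hlB) (by omega)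
          intro v hv
          simp only [mem_frontier, List.mem_append, List.mem_cons] at hv ⊢
          obtain ⟨⟨e, he, hve⟩, hv2⟩ := hv
          rcases hv2 with rfl | ⟨f, hf, hvf⟩
          · exact Or.inl rfl
          have hfB : f ∈ lB := by rw [hlB]; simp [hf]
          have hrv := rB f hfB v hvf
          rcases he with he | rfl | he
          · exact (hdisj v hrv (rC e he v hve)).elim
          · rcases Sym2.mem_iff.1 hve with rfl | rfl
            · exact Or.inl rfl
            · exact (hbr hrv).elim
          · exact Or.inr ⟨⟨e, he, hve⟩, Or.inr ⟨f, hf, hvf⟩⟩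
      · refine (hC.card_le l₁ t hlC).trans' (Nat.pow_le_pow_right (by norm_num)
            (Finset.card_le_card ?_)) |>.trans (by omega)
        intro v hv
        simp only [mem_frontier, List.mem_append, List.mem_cons] at hv ⊢
        obtain ⟨⟨e, he, hve⟩, hv2⟩ := hv
        refine ⟨⟨e, he, hve⟩, ?_⟩
        have hcv := rC e (by rw [hlC]; simp [he]) v hve
        rcases hv2 with rfl | ⟨f, hf | rfl | hf, hvf⟩
        · exact (hbr hcv.symm).elim
        · exact Or.inr ⟨f, hf, hvf⟩
        · rcases Sym2.mem_iff.1 hvf with rfl | rfl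
          · exact (hbr hcv.symm).elim
          · exact Or.inl rfl
        · exact (hdisj v (rB f hf v hvf) hcv).elim
  · refine ⟨lB ++ (lC ++ [s(r, c)]), ?_, fun e => ?_, fun l₁ l₂ h => ?_⟩
    · rw [List.nodup_append, List.nodup_append]
      refine ⟨hB.nodup, ⟨hC.nodup, List.nodup_singleton _, fun e h1 f h2 hef => ?_⟩,
        fun e h1 f h2 hef => ?_⟩
      · subst hef
        exact heC (List.mem_singleton.1 h2 ▸ h1)
      · subst hef
        rcases List.mem_append.1 h2 with h2 | h2
        · exact hBC e h1 h2
        · exact heB (List.mem_singleton.1 h2 ▸ h1)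
    · rw [← hmem, List.mem_append, List.mem_append, List.mem_singleton]; tauto
    · rcases List.append_eq_append_iff.1 h with ⟨t, rfl, ht⟩ | ⟨t, hlB, rfl⟩
      · rcases List.append_eq_append_iff.1 ht with ⟨t', rfl, ht'⟩ | ⟨u, hlC, rfl⟩
        · refine pow_two_card_le_of_subset_insert (r := r) ?_ (hC.card_le lC [] (by simp)) (by omega)
          intro v hv
          simp only [mem_frontier, List.mem_append] at hv ⊢
          obtain ⟨⟨e, he, hve⟩, rfl | ⟨f, hf, hvf⟩⟩ := hv
          · exact Or.inl rfl
          have hf' : f = s(r, c) := List.mem_singleton.1 (ht' ▸ List.mem_append_right _ hf)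
          have ht0 : t' = [] := by
            rcases List.append_eq_singleton_iff.1 ht'.symm with h | h
            · exact h.1
            · rw [h.2] at hf; simp at hf
          subst hf' ht0
          rcases Sym2.mem_iff.1 hvf with rfl | rfl
          · exact Or.inl rfl
          rcases he with he | he
          · exact (hbr (rB e he v hve)).elim
          · exact Or.inr ⟨⟨e, by simpa using he, hve⟩, Or.inl rfl⟩
        · refine pow_two_card_le_of_subset_insert (r := r) ?_ (hC.card_le t u hlC) (by omega)
          intro v hv
          simp only [mem_frontier, List.mem_append, List.mem_singleton] at hv ⊢
          obtain ⟨⟨e, he, hve⟩, rfl | ⟨f, hf, hvf⟩⟩ := hv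
          · exact Or.inl rfl
          rcases hf with hf | rfl
          · have hcv := rC f (by rw [hlC]; simp [hf]) v hvf
            rcases he with he | he
            · exact (hdisj v (rB e he v hve) hcv).elim
            · exact Or.inr ⟨⟨e, he, hve⟩, Or.inr ⟨f, hf, hvf⟩⟩
          · rcases Sym2.mem_iff.1 hvf with rfl | rfl
            · exact Or.inl rfl
            · rcases he with he | he
              · exact (hbr (rB e he v hve)).elim
              · exact Or.inr ⟨⟨e, he, hve⟩, Or.inl rfl⟩
      · refine (hB.card_le l₁ t hlB).trans' (Nat.pow_le_pow_right (by norm_num)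
            (Finset.card_le_card ?_)) |>.trans (by omega)
        intro v hv
        simp only [mem_frontier, List.mem_append, List.mem_singleton] at hv ⊢
        obtain ⟨⟨e, he, hve⟩, hv2⟩ := hv
        refine ⟨⟨e, he, hve⟩, ?_⟩
        have hrv := rB e (by rw [hlB]; simp [he]) v hve
        rcases hv2 with rfl | ⟨f, hf | hf | rfl, hvf⟩
        · exact Or.inl rfl
        · exact Or.inr ⟨f, hf, hvf⟩
        · exact (hdisj v hrv (rC f hf v hvf)).elim
        · rcases Sym2.mem_iff.1 hvf with rfl | rfl
          · exact Or.inl rfl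
          · exact (hbr hrv).elim

end Ordering

end SimpleGraph

/-! ### Reversible lazy chains: from a Poincaré inequality to the mixing time -/

section Markov

variable {Ω : Type*} [Fintype Ω]

/-- The Dirichlet form `(1/2) ∑ₓ ∑ᵧ π x * P x y * (f x - f y)²`. -/
noncomputable def dirichletForm (P : Matrix Ω Ω ℝ) (π : Ω → ℝ) (f : Ω → ℝ) : ℝ :=
  (1 / 2) * ∑ x, ∑ y, π x * P x y * (f x - f y) ^ 2

/-- The variance `∑ₓ π x * (f x)² - (∑ₓ π x * f x)²` of a function. -/
noncomputable def piVariance (π : Ω → ℝ) (f : Ω → ℝ) : ℝ :=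
  ∑ x, π x * f x ^ 2 - (∑ x, π x * f x) ^ 2

/-- `P` is stochastic, reversible with respect to the positive distribution `π`, and stays put with
probability at least `1/2`. -/
structure IsLazyReversible (P : Matrix Ω Ω ℝ) (π : Ω → ℝ) : Prop where
  pos : ∀ x, 0 < π x
  sum_eq_one : ∑ x, π x = 1
  nonneg : ∀ x y, 0 ≤ P x y
  row_sum : ∀ x, ∑ y, P x y = 1
  detailed_balance : ∀ x y, π x * P x y = π y * P y x
  half_le : ∀ x, 1 / 2 ≤ P x x

lemma piVariance_eq_sum_sq_sub {π : Ω → ℝ} (hπ : ∑ x, π x = 1) (f : Ω → ℝ) :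
    piVariance π f = (1 / 2) * ∑ x, ∑ y, π x * π y * (f x - f y) ^ 2 := by
  have h : ∀ x y, π x * π y * (f x - f y) ^ 2 =
      (π x * f x ^ 2) * π y + π x * (π y * f y ^ 2) - 2 * ((π x * f x) * (π y * f y)) := by
    intro x y; ring
  simp only [h, Finset.sum_sub_distrib, Finset.sum_add_distrib, ← Finset.mul_sum,
    ← Finset.sum_mul, hπ, piVariance]
  ring

lemma piVariance_eq_sum_sq_sub_mean {π : Ω → ℝ} (hπ : ∑ x, π x = 1) (f : Ω → ℝ) :
    piVariance π f = ∑ x, π x * (f x - ∑ y, π y * f y) ^ 2 := by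
  set m := ∑ y, π y * f y with hm
  have h : ∀ x, π x * (f x - m) ^ 2 = π x * f x ^ 2 - 2 * m * (π x * f x) + m ^ 2 * π x := by
    intro x; ring
  simp only [h, Finset.sum_add_distrib, Finset.sum_sub_distrib, ← Finset.mul_sum, hπ, ← hm,
    piVariance]
  ring

lemma dirichletForm_eq {Q : Matrix Ω Ω ℝ} {π : Ω → ℝ} (hrow : ∀ x, ∑ y, Q x y = 1)
    (hrev : ∀ x y, π x * Q x y = π y * Q y x) (f : Ω → ℝ) :
    dirichletForm Q π f = ∑ x, π x * f x ^ 2 - ∑ x, π x * f x * Q.mulVec f x := by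
  have h : ∀ x y, π x * Q x y * (f x - f y) ^ 2 =
      (π x * f x ^ 2) * Q x y + π y * f y ^ 2 * Q y x - 2 * (π x * f x * (Q x y * f y)) := by
    intro x y
    linear_combination (f y ^ 2) * hrev x y
  have h2 : ∑ x, ∑ y, π y * f y ^ 2 * Q y x = ∑ x, π x * f x ^ 2 := by
    rw [Finset.sum_comm]
    simp only [← Finset.mul_sum, hrow, mul_one]
  simp only [dirichletForm, h, Finset.sum_sub_distrib, Finset.sum_add_distrib, h2]
  simp only [← Finset.mul_sum, hrow, Matrix.mulVec, dotProduct]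
  ring_nf

namespace IsLazyReversible

variable {P : Matrix Ω Ω ℝ} {π : Ω → ℝ} (h : IsLazyReversible P π)
include h

lemma sum_mul_mulVec (f g : Ω → ℝ) :
    ∑ x, π x * f x * P.mulVec g x = ∑ x, π x * P.mulVec f x * g x := by
  simp only [Matrix.mulVec, dotProduct, Finset.mul_sum, Finset.sum_mul]
  rw [Finset.sum_comm]
  refine Finset.sum_congr rfl fun x _ => Finset.sum_congr rfl fun y _ => ?_
  linear_combination (f y * g x) * h.detailed_balance y x

lemma sum_mulVec (f : Ω → ℝ) : ∑ x, π x * P.mulVec f x = ∑ x, π x * f x := by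
  have h1 := h.sum_mul_mulVec (fun _ => 1) f
  have h2 : P.mulVec (fun _ => 1) = fun _ => 1 := by
    ext x; simp [Matrix.mulVec, dotProduct, h.row_sum]
  rw [h2] at h1
  simpa using h1

/-- One step of the chain decreases the variance by the Dirichlet form: by exactly the Dirichlet
form of `P * P`, whose off-diagonal entries dominate those of `P` as `P` is lazy. -/
lemma piVariance_mulVec_le (f : Ω → ℝ) :
    piVariance π (P.mulVec f) ≤ piVariance π f - dirichletForm P π f := by
  have hrow : ∀ x, ∑ y, (P * P) x y = 1 := by
    intro x
    simp only [Matrix.mul_apply]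
    rw [Finset.sum_comm]
    simp only [← Finset.mul_sum, h.row_sum, mul_one]
  have hrev : ∀ x y, π x * (P * P) x y = π y * (P * P) y x := by
    intro x y
    simp only [Matrix.mul_apply, Finset.mul_sum]
    refine Finset.sum_congr rfl fun z _ => ?_
    linear_combination P z y * h.detailed_balance x z + P z x * h.detailed_balance z y
  have h1 : dirichletForm (P * P) π f = piVariance π f - piVariance π (P.mulVec f) := by
    rw [dirichletForm_eq hrow hrev, piVariance, piVariance, h.sum_mulVec,
      ← Matrix.mulVec_mulVec, h.sum_mul_mulVec]
    have : ∀ x, π x * P.mulVec f x ^ 2 = π x * P.mulVec f x * P.mulVec f x := fun x => by ring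
    simp only [this]
    ring
  have h2 : dirichletForm P π f ≤ dirichletForm (P * P) π f := by
    unfold dirichletForm
    refine mul_le_mul_of_nonneg_left (Finset.sum_le_sum fun x _ => Finset.sum_le_sum fun y _ => ?_)
      (by norm_num)
    rcases eq_or_ne x y with rfl | hxy
    · simp
    refine mul_le_mul_of_nonneg_right (mul_le_mul_of_nonneg_left ?_ (h.pos x).le) (sq_nonneg _)
    classical
    rw [Matrix.mul_apply]
    calc P x y ≤ ∑ z ∈ {x, y}, P x z * P z y := by
          rw [Finset.sum_pair hxy]
          nlinarith [h.half_le x, h.half_le y, h.nonneg x y]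
      _ ≤ _ := Finset.sum_le_sum_of_subset_of_nonneg (Finset.subset_univ _)
          fun z _ _ => mul_nonneg (h.nonneg _ _) (h.nonneg _ _)
  linarith

variable [DecidableEq Ω]

lemma detailed_balance_pow (t : ℕ) (x y : Ω) : π x * (P ^ t) x y = π y * (P ^ t) y x := by
  induction t generalizing x y with
  | zero =>
    rcases eq_or_ne x y with rfl | hxy
    · rfl
    · simp [hxy, hxy.symm]
  | succ t ih =>
    rw [pow_succ, Matrix.mul_apply, ← pow_succ, pow_succ', Matrix.mul_apply, Finset.mul_sum,
      Finset.mul_sum]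
    refine Finset.sum_congr rfl fun z _ => ?_
    linear_combination P z y * ih x z + (P ^ t) z x * h.detailed_balance z y

/-- Variance decay of the densities `y ↦ P ^ t (x, y) / π y`, starting at a point mass. -/
theorem tvDist_pow_le {ρ : ℝ} (hρ : 1 ≤ ρ)
    (hP : ∀ f : Ω → ℝ, piVariance π f ≤ ρ * dirichletForm P π f) (t : ℕ) (x : Ω) :
    tvDist (fun y => (P ^ t) x y) π ^ 2 ≤ (1 - 1 / ρ) ^ t / π x := by
  have hρ0 : 0 < ρ := by linarith
  set f : ℕ → Ω → ℝ := fun t => (P ^ t).mulVec (Pi.single x (1 / π x)) with hf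
  have hft : ∀ t y, f t y * π y = (P ^ t) x y := by
    intro t y
    have hx := (h.pos x).ne'
    simp only [hf, Matrix.mulVec_single, MulOpposite.smul_eq_mul_unop, Pi.smul_apply,
      Matrix.col_apply, MulOpposite.unop_op]
    field_simp
    linear_combination h.detailed_balance_pow t y x
  have hmean : ∀ t, ∑ y, π y * f t y = 1 := by
    intro t
    induction t with
    | zero =>
      simp only [hf, pow_zero, Matrix.one_mulVec]
      simp [Pi.single_apply, (h.pos x).ne']
    | succ t ih =>
      rw [← ih, ← h.sum_mulVec (f t)]
      simp only [hf, pow_succ', Matrix.mulVec_mulVec]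
  have hvar : ∀ t, piVariance π (f t) ≤ (1 - 1 / ρ) ^ t / π x := by
    intro t
    induction t with
    | zero =>
      have : ∑ y, π y * f 0 y ^ 2 = 1 / π x := by
        simp only [hf, pow_zero, Matrix.one_mulVec]
        rw [Finset.sum_eq_single x (fun y _ hy => by simp [hy]) (by simp)]
        have := (h.pos x).ne'
        simp; field_simp
      rw [piVariance, this, pow_zero]
      linarith [sq_nonneg (∑ y, π y * f 0 y)]
    | succ t ih =>
      have hstep := h.piVariance_mulVec_le (f t)
      have he : P.mulVec (f t) = f (t + 1) := by
        simp only [hf, pow_succ', Matrix.mulVec_mulVec]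
      rw [he] at hstep
      have hd : piVariance π (f t) / ρ ≤ dirichletForm P π (f t) := by
        rw [div_le_iff₀ hρ0, mul_comm]; exact hP _
      have h1 : (0 : ℝ) ≤ 1 - 1 / ρ := by
        rw [sub_nonneg, div_le_one hρ0]; exact hρ
      calc piVariance π (f (t + 1)) ≤ (1 - 1 / ρ) * piVariance π (f t) := by
            have : (1 - 1 / ρ) * piVariance π (f t) =
              piVariance π (f t) - piVariance π (f t) / ρ := by ring
            linarith
        _ ≤ (1 - 1 / ρ) * ((1 - 1 / ρ) ^ t / π x) := mul_le_mul_of_nonneg_left ih h1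
        _ = _ := by ring
  refine le_trans ?_ (hvar t)
  rw [piVariance_eq_sum_sq_sub_mean h.sum_eq_one, hmean]
  have hcs := Finset.sum_mul_sq_le_sq_mul_sq Finset.univ (fun y => √(π y))
    (fun y => √(π y) * |f t y - 1|)
  have e1 : ∀ y, √(π y) * (√(π y) * |f t y - 1|) = |(P ^ t) x y - π y| := by
    intro y
    rw [← mul_assoc, Real.mul_self_sqrt (h.pos y).le, ← hft t y]
    rw [← abs_of_pos (h.pos y), ← abs_mul, abs_of_pos (h.pos y)]
    ring_nf
  have e2 : ∀ y, (√(π y) * |f t y - 1|) ^ 2 = π y * (f t y - 1) ^ 2 := by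
    intro y
    rw [mul_pow, Real.sq_sqrt (h.pos y).le, sq_abs]
  simp only [e1, e2, Real.sq_sqrt (h.pos _).le, h.sum_eq_one, one_mul] at hcs
  rw [tvDist, mul_pow]
  nlinarith [sq_nonneg (∑ y, |(P ^ t) x y - π y|)]

/-- A Poincaré inequality with constant `ρ` gives a mixing time of order
`ρ * (log (1 / min π) + log (1 / ε))`. -/
theorem exists_mixingTime_eq {ρ L ε : ℝ} (hρ : 1 ≤ ρ)
    (hP : ∀ f : Ω → ℝ, piVariance π f ≤ ρ * dirichletForm P π f)
    (hL : ∀ x, Real.log (1 / π x) ≤ L) (hL0 : 0 ≤ L) (hε : 0 < ε) (hε1 : ε < 1) :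
    ∃ t : ℕ, mixingTime P π ε = t ∧ (t : ℝ) ≤ ρ * (L + 2 * Real.log (1 / ε)) + 1 := by
  have hρ0 : 0 < ρ := by linarith
  set s : ℝ := ρ * (L + 2 * Real.log (1 / ε)) with hs
  have hlog : 0 ≤ Real.log (1 / ε) := Real.log_nonneg (by rw [le_div_iff₀ hε]; linarith)
  have hs0 : 0 ≤ s := by positivity
  have hle : mixingTime P π ε ≤ (⌈s⌉₊ : ℕ) := by
    refine iSup_le fun x => iInf₂_le _ ?_
    have htv : tvDist (fun y => (P ^ ⌈s⌉₊) x y) π ^ 2 ≤ ε ^ 2 := by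
      refine (h.tvDist_pow_le hρ hP _ x).trans ?_
      have hπ := h.pos x
      rw [div_le_iff₀ hπ]
      have h1 : (0 : ℝ) ≤ 1 - 1 / ρ := by
        rw [sub_nonneg, div_le_one hρ0]; exact hρ
      calc (1 - 1 / ρ) ^ ⌈s⌉₊ ≤ Real.exp (-(1 / ρ)) ^ ⌈s⌉₊ :=
            pow_le_pow_left₀ h1 (Real.one_sub_le_exp_neg _) _
        _ = Real.exp (-(⌈s⌉₊ / ρ)) := by
            rw [← Real.exp_nat_mul]; ring_nf
        _ ≤ Real.exp (Real.log (ε ^ 2 * π x)) := by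
            rw [Real.exp_le_exp, Real.log_mul (by positivity) hπ.ne', Real.log_pow]
            have h2 : s / ρ ≤ ⌈s⌉₊ / ρ := div_le_div_of_nonneg_right (Nat.le_ceil s) hρ0.le
            have h3 : s / ρ = L + 2 * Real.log (1 / ε) := by
              rw [hs]; field_simp
            have h4 := hL x
            rw [one_div, Real.log_inv] at h4 h3
            push_cast
            linarith
        _ = ε ^ 2 * π x := Real.exp_log (by positivity)
    exact le_of_sq_le_sq htv hε.le
  obtain ⟨t, ht⟩ := ENat.ne_top_iff_exists.1 (ne_top_of_le_ne_top (ENat.natCast_ne_top _) hle)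
  refine ⟨t, ht.symm, ?_⟩
  rw [← ht, Nat.cast_le] at hle
  exact (Nat.cast_le.2 hle).trans (Nat.ceil_lt_add_one hs0).le

end IsLazyReversible

end Markov

/-! ### Canonical paths that exchange two sets element by element -/

section Splice

open Finset

variable {α : Type*} [DecidableEq α]

lemma Finset.splice_splice (K I F : Finset α) : K.splice (K.splice I F) (K.splice F I) = I := by
  ext a; simp only [splice, mem_union, mem_inter, mem_sdiff]; tauto

lemma Finset.card_splice_add (K I F : Finset α) :
    (K.splice I F).card + (K.splice F I).card = I.card + F.card := by
  have h : ∀ A B : Finset α, (K.splice A B).card = (B ∩ K).card + (A \ K).card := fun A B =>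
    card_union_of_disjoint (disjoint_left.2 fun a h1 h2 => by
      simp only [mem_inter, mem_sdiff] at h1 h2; exact h2.2 h1.2)
  rw [h, h, ← card_inter_add_card_sdiff I K, ← card_inter_add_card_sdiff F K]
  omega

lemma Finset.splice_insert {K I F : Finset α} {e : α} (he : e ∉ K) (h : e ∈ I ↔ e ∈ F) :
    (insert e K).splice I F = K.splice I F := by
  ext a
  simp only [splice, mem_union, mem_inter, mem_sdiff, mem_insert]
  by_cases hae : a = e
  · subst hae; tauto
  · tauto

lemma Finset.splice_insert_symmDiff {K I F : Finset α} {e : α} (he : e ∉ K)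
    (h : ¬ (e ∈ I ↔ e ∈ F)) :
    (insert e K).splice I F = symmDiff (K.splice I F) {e} := by
  ext a
  simp only [splice, mem_union, mem_inter, mem_sdiff, mem_insert, mem_symmDiff, mem_singleton]
  by_cases hae : a = e
  · subst hae; tauto
  · tauto

variable [Fintype α]

/-- The map `(I, F) ↦ (K.splice I F, K.splice F I)` is an involution on pairs. -/
lemma Finset.sum_splice (K : Finset α) (φ : Finset α → Finset α → ℝ) :
    ∑ I, ∑ F, φ (K.splice I F) (K.splice F I) = ∑ S, ∑ T, φ S T := by
  rw [← Fintype.sum_prod_type', ← Fintype.sum_prod_type']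
  have hinv : Function.Involutive
      fun p : Finset α × Finset α => (K.splice p.1 p.2, K.splice p.2 p.1) := fun p => by
    simp only [splice_splice]
  exact Equiv.sum_comp hinv.toPerm fun p : Finset α × Finset α => φ p.1 p.2

/-- The contribution of one step of all canonical paths: the pair `(S, T)` of sets obtained by
exchanging `I` and `F` inside `K` encodes `(I, F)`, so that the move from `S` to
`S ∆ {e}` is charged at most `2 * Λ * min (π S) (π (S ∆ {e}))`. -/
lemma sum_splice_step_le {π : Finset α → ℝ} (hpos : ∀ S, 0 < π S) (hsum : ∑ S, π S = 1) {Λ : ℝ}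
    (hΛ : 0 ≤ Λ) {K : Finset α} {e : α} (he : e ∉ K)
    (hK : ∀ I F, π I * π F ≤ Λ * (π (K.splice I F) * π (K.splice F I)))
    (hK' : ∀ I F, π I * π F ≤
      Λ * (π ((insert e K).splice I F) * π ((insert e K).splice F I))) (f : Finset α → ℝ) :
    ∑ I, ∑ F, π I * π F * (f (K.splice I F) - f ((insert e K).splice I F)) ^ 2 ≤
      2 * Λ * ∑ S, min (π S) (π (symmDiff S {e})) * (f S - f (symmDiff S {e})) ^ 2 := by
  set q : Finset α → ℝ :=
    fun S => min (π S) (π (symmDiff S {e})) * (f S - f (symmDiff S {e})) ^ 2 with hq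
  have hpt : ∀ I F, π I * π F * (f (K.splice I F) - f ((insert e K).splice I F)) ^ 2 ≤
      (fun S T => Λ * q S * (π T + π (symmDiff T {e}))) (K.splice I F) (K.splice F I) := by
    intro I F
    by_cases h : e ∈ I ↔ e ∈ F
    · rw [Finset.splice_insert he h, sub_self]
      have := hpos (K.splice I F)
      have := hpos (K.splice F I)
      have := hpos (symmDiff (K.splice F I) {e})
      have := hpos (symmDiff (K.splice I F) {e})
      simp only [hq]
      have h0 : 0 ≤ min (π (K.splice I F)) (π (symmDiff (K.splice I F) {e})) := by positivity
      rw [zero_pow two_ne_zero, mul_zero]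
      positivity
    · have h1 := hK I F
      have h2 := hK' I F
      rw [Finset.splice_insert_symmDiff he h,
        Finset.splice_insert_symmDiff he (fun h' => h h'.symm)] at h2
      rw [Finset.splice_insert_symmDiff he h]
      set S := K.splice I F
      set T := K.splice F I
      have hS := hpos S
      have hS' := hpos (symmDiff S {e})
      have hT := hpos T
      have hT' := hpos (symmDiff T {e})
      have key : π I * π F ≤
          Λ * min (π S) (π (symmDiff S {e})) * (π T + π (symmDiff T {e})) := by
        rcases le_total (π S) (π (symmDiff S {e})) with hle | hle
        · rw [min_eq_left hle]
          have : 0 ≤ Λ * π S * π (symmDiff T {e}) := by positivity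
          linarith
        · rw [min_eq_right hle]
          have : 0 ≤ Λ * π (symmDiff S {e}) * π T := by positivity
          linarith
      calc _ ≤ Λ * min (π S) (π (symmDiff S {e})) * (π T + π (symmDiff T {e})) *
            (f S - f (symmDiff S {e})) ^ 2 := mul_le_mul_of_nonneg_right key (sq_nonneg _)
        _ = _ := by simp only [hq]; ring
  refine (Finset.sum_le_sum fun I _ => Finset.sum_le_sum fun F _ => hpt I F).trans ?_
  refine (Finset.sum_splice K fun S T => Λ * q S * (π T + π (symmDiff T {e}))).le.trans ?_
  have hflip : ∑ T : Finset α, π (symmDiff T {e}) = 1 := by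
    rw [← hsum]
    have hinv : Function.Involutive fun T : Finset α => symmDiff T {e} := fun T =>
      symmDiff_symmDiff_cancel_right _ _
    exact Equiv.sum_comp hinv.toPerm π
  simp only [← Finset.mul_sum, Finset.sum_add_distrib, hsum, hflip]
  rw [← Finset.sum_mul, ← Finset.mul_sum]
  linarith

/-- A Poincaré inequality from the canonical paths that exchange `I` for `F` in the order `l`, under
the hypothesis that all intermediate exchanges keep the product of weights up to the factor `Λ`. -/
theorem piVariance_le_of_splice {π : Finset α → ℝ} (hpos : ∀ S, 0 < π S) (hsum : ∑ S, π S = 1)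
    {Λ : ℝ} (hΛ : 0 ≤ Λ) {l : List α} (hl : l.Nodup) (hmem : ∀ a, a ∈ l)
    (hK : ∀ t I F, π I * π F ≤
      Λ * (π ((l.take t).toFinset.splice I F) * π ((l.take t).toFinset.splice F I)))
    (f : Finset α → ℝ) :
    piVariance π f ≤ Fintype.card α * Λ *
      ∑ e, ∑ S, min (π S) (π (symmDiff S {e})) * (f S - f (symmDiff S {e})) ^ 2 := by
  have hcard : l.length = Fintype.card α := by
    simpa using Fintype.card_congr (hl.getEquivOfForallMemList l hmem)
  set H : ℕ → Finset α → Finset α → Finset α := fun t => (l.take t).toFinset.splice with hH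
  have hH0 : ∀ I F, H 0 I F = I := by intro I F; simp [hH, Finset.splice]
  have hH1 : ∀ I F, H l.length I F = F := by
    intro I F
    have : l.toFinset = Finset.univ := by ext a; simp [hmem]
    simp [hH, Finset.splice, this]
  have htel : ∀ I F, (f I - f F) ^ 2 ≤
      l.length * ∑ t ∈ Finset.range l.length, (f (H t I F) - f (H (t + 1) I F)) ^ 2 := by
    intro I F
    have h1 := Finset.sum_range_sub' (fun t => f (H t I F)) l.length
    simp only [hH0, hH1] at h1
    rw [← h1]
    simpa using sq_sum_le_card_mul_sum_sq (s := Finset.range l.length)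
      (f := fun t => f (H t I F) - f (H (t + 1) I F))
  have hstep : ∀ t : Fin l.length,
      ∑ I, ∑ F, π I * π F * (f (H t I F) - f (H (t + 1) I F)) ^ 2 ≤
      2 * Λ * ∑ S, min (π S) (π (symmDiff S {l.get t})) *
        (f S - f (symmDiff S {l.get t})) ^ 2 := by
    intro t
    have hins : (l.take (t + 1)).toFinset = insert (l.get t) (l.take t).toFinset := by
      rw [List.take_succ_eq_append_getElem t.2]
      ext a
      simp only [List.mem_toFinset, List.mem_append, List.mem_singleton, Finset.mem_insert,
        List.get_eq_getElem, or_comm]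
    have hnot : l.get t ∉ (l.take t).toFinset := by
      rw [List.mem_toFinset, List.mem_take_iff_getElem]
      rintro ⟨i, hi, hget⟩
      have := (List.Nodup.getElem_inj_iff hl).1 hget
      omega
    have h1 := hK (t + 1)
    rw [hins] at h1
    have := sum_splice_step_le hpos hsum hΛ hnot (hK t) h1 f
    simp only [hH, hins]
    exact this
  rw [piVariance_eq_sum_sq_sub hsum]
  calc (1 / 2) * ∑ I, ∑ F, π I * π F * (f I - f F) ^ 2
      ≤ (1 / 2) * ∑ I, ∑ F, π I * π F * (l.length *
          ∑ t ∈ Finset.range l.length, (f (H t I F) - f (H (t + 1) I F)) ^ 2) := by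
        refine mul_le_mul_of_nonneg_left (Finset.sum_le_sum fun I _ => Finset.sum_le_sum
          fun F _ => mul_le_mul_of_nonneg_left (htel I F) ?_) (by norm_num)
        exact mul_nonneg (hpos I).le (hpos F).le
    _ = (1 / 2) * l.length * ∑ t : Fin l.length, ∑ I, ∑ F,
          π I * π F * (f (H t I F) - f (H (t + 1) I F)) ^ 2 := by
        rw [← Finset.sum_range (fun t => ∑ I, ∑ F,
          π I * π F * (f (H t I F) - f (H (t + 1) I F)) ^ 2)]
        rw [Finset.sum_comm (s := Finset.range _)]
        simp only [Finset.mul_sum]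
        refine Finset.sum_congr rfl fun I _ => ?_
        rw [Finset.sum_comm (s := Finset.range _)]
        exact Finset.sum_congr rfl fun F _ => Finset.sum_congr rfl fun t _ => by ring
    _ ≤ (1 / 2) * l.length * ∑ t : Fin l.length, 2 * Λ * ∑ S,
          min (π S) (π (symmDiff S {l.get t})) * (f S - f (symmDiff S {l.get t})) ^ 2 :=
        mul_le_mul_of_nonneg_left (Finset.sum_le_sum fun t _ => hstep t) (by positivity)
    _ = _ := by
        rw [← hcard, ← Finset.mul_sum]
        rw [← Equiv.sum_comp (hl.getEquivOfForallMemList l hmem)]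
        simp only [List.Nodup.getEquivOfForallMemList_apply]
        ring

end Splice

/-! ### The single bond flip chain as a lazy reversible chain -/

namespace RWS

section Chain

open scoped Classical

variable {V : Type*} [Fintype V]

lemma weight_pos {G : SimpleGraph V} (U W : Set V) {lam mu : ℝ} (hlam : 0 < lam) (hmu : 0 < mu)
    (S : Finset G.edgeSet) : 0 < weight U W lam mu S :=
  mul_pos (pow_pos hlam _) (pow_pos hmu _)

lemma sum_weight_pos (G : SimpleGraph V) (U W : Set V) {lam mu : ℝ} (hlam : 0 < lam)
    (hmu : 0 < mu) : 0 < ∑ T : Finset G.edgeSet, weight U W lam mu T :=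
  Finset.sum_pos (fun T _ => weight_pos U W hlam hmu T) Finset.univ_nonempty

lemma dist_pos (G : SimpleGraph V) (U W : Set V) {lam mu : ℝ} (hlam : 0 < lam) (hmu : 0 < mu)
    (S : Finset G.edgeSet) : 0 < dist G U W lam mu S :=
  div_pos (weight_pos U W hlam hmu S) (sum_weight_pos G U W hlam hmu)

lemma sum_dist (G : SimpleGraph V) (U W : Set V) {lam mu : ℝ} (hlam : 0 < lam) (hmu : 0 < mu) :
    ∑ S, dist G U W lam mu S = 1 := by
  simp only [dist]
  rw [← Finset.sum_div, div_self (sum_weight_pos G U W hlam hmu).ne']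

lemma flipProb_nonneg {G : SimpleGraph V} (U W : Set V) {lam mu : ℝ} (hlam : 0 < lam)
    (hmu : 0 < mu) (X : Finset G.edgeSet) (e : G.edgeSet) : 0 ≤ flipProb U W lam mu X e := by
  unfold flipProb
  positivity

lemma sum_flipProb_le {G : SimpleGraph V} (U W : Set V) (lam mu : ℝ)
    (X : Finset G.edgeSet) : ∑ e, flipProb U W lam mu X e ≤ 1 / 2 := by
  have h : ∀ e : G.edgeSet, flipProb U W lam mu X e ≤ 1 / (Fintype.card G.edgeSet : ℝ) * (1 / 2) :=
    fun e => mul_le_mul_of_nonneg_left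
      (by linarith [min_le_left (1 : ℝ) (lam ^ ((rk₂ U W (symmDiff X {e}) : ℤ) - (rk₂ U W X : ℤ)) *
        mu ^ (((symmDiff X {e}).card : ℤ) - (X.card : ℤ)))]) (by positivity)
  refine (Finset.sum_le_sum fun e _ => h e).trans ?_
  rw [Finset.sum_const, Finset.card_univ, nsmul_eq_mul, ← mul_assoc]
  have : (Fintype.card G.edgeSet : ℝ) * (1 / (Fintype.card G.edgeSet : ℝ)) ≤ 1 := by
    rw [mul_one_div]; exact div_self_le_one _
  linarith

lemma dist_mul_flipProb (G : SimpleGraph V) (U W : Set V) {lam mu : ℝ} (hlam : 0 < lam)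
    (hmu : 0 < mu) (X : Finset G.edgeSet) (e : G.edgeSet) :
    dist G U W lam mu X * flipProb U W lam mu X e = 1 / (2 * (Fintype.card G.edgeSet : ℝ)) *
      min (dist G U W lam mu X) (dist G U W lam mu (symmDiff X {e})) := by
  have hX := weight_pos U W hlam hmu X
  have hratio : lam ^ ((rk₂ U W (symmDiff X {e}) : ℤ) - (rk₂ U W X : ℤ)) *
        mu ^ (((symmDiff X {e}).card : ℤ) - (X.card : ℤ)) =
      dist G U W lam mu (symmDiff X {e}) / dist G U W lam mu X := by
    rw [dist, dist, div_div_div_cancel_right₀ (sum_weight_pos G U W hlam hmu).ne',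
      zpow_sub₀ hlam.ne', zpow_sub₀ hmu.ne', weight, weight]
    simp only [zpow_natCast]
    rw [div_mul_div_comm]
  have hd := dist_pos G U W hlam hmu X
  rw [flipProb, hratio]
  have : dist G U W lam mu X * min 1 (dist G U W lam mu (symmDiff X {e}) / dist G U W lam mu X) =
      min (dist G U W lam mu X) (dist G U W lam mu (symmDiff X {e})) := by
    rw [mul_min_of_nonneg _ _ hd.le, mul_one, mul_div_cancel₀ _ hd.ne']
  rw [← this, one_div_mul_eq_div, one_div_mul_eq_div, one_div_mul_eq_div]
  field_simp

lemma sum_transition_mul (G : SimpleGraph V) (U W : Set V) (lam mu : ℝ) (X : Finset G.edgeSet)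
    (g : Finset G.edgeSet → ℝ) :
    ∑ Y, transition G U W lam mu X Y * g Y =
      ∑ e, flipProb U W lam mu X e * g (symmDiff X {e}) +
        (1 - ∑ e, flipProb U W lam mu X e) * g X := by
  simp only [transition, Matrix.of_apply, add_mul, Finset.sum_add_distrib, Finset.sum_mul, ite_mul,
    zero_mul, Finset.sum_ite_eq, Finset.mem_univ, if_true]
  rw [Finset.sum_comm]
  simp

lemma isLazyReversible (G : SimpleGraph V) (U W : Set V) {lam mu : ℝ} (hlam : 0 < lam)
    (hmu : 0 < mu) : IsLazyReversible (transition G U W lam mu) (dist G U W lam mu) where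
  pos := dist_pos G U W hlam hmu
  sum_eq_one := sum_dist G U W hlam hmu
  nonneg X Y := by
    have h1 := sum_flipProb_le U W lam mu X
    refine add_nonneg (Finset.sum_nonneg fun e _ => ?_) ?_
    · split_ifs
      exacts [flipProb_nonneg U W hlam hmu X e, le_rfl]
    · split_ifs
      exacts [by linarith, le_rfl]
  row_sum X := by
    have := sum_transition_mul G U W lam mu X (fun _ => 1)
    simp only [mul_one] at this
    rw [this]; ring
  detailed_balance X Y := by
    rcases eq_or_ne X Y with rfl | hne
    · rfl
    simp only [transition, Matrix.of_apply, if_neg hne, if_neg hne.symm, add_zero, Finset.mul_sum]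
    refine Finset.sum_congr rfl fun e _ => ?_
    by_cases h : symmDiff X {e} = Y
    · have h' : symmDiff Y {e} = X := by rw [← h]; exact symmDiff_symmDiff_cancel_right _ _
      rw [if_pos h, if_pos h', dist_mul_flipProb G U W hlam hmu, dist_mul_flipProb G U W hlam hmu,
        h, h', min_comm]
    · have h' : symmDiff Y {e} ≠ X := fun h' => h (by
        rw [← h']; exact symmDiff_symmDiff_cancel_right _ _)
      rw [if_neg h, if_neg h', mul_zero, mul_zero]
  half_le X := by
    have h1 := sum_flipProb_le U W lam mu X
    simp only [transition, Matrix.of_apply, if_true]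
    have : 0 ≤ ∑ e, if symmDiff X {e} = X then flipProb U W lam mu X e else 0 :=
      Finset.sum_nonneg fun e _ => by
        split_ifs
        exacts [flipProb_nonneg U W hlam hmu X e, le_rfl]
    linarith

lemma dirichletForm_transition (G : SimpleGraph V) (U W : Set V) {lam mu : ℝ} (hlam : 0 < lam)
    (hmu : 0 < mu) (f : Finset G.edgeSet → ℝ) :
    ∑ e, ∑ S, min (dist G U W lam mu S) (dist G U W lam mu (symmDiff S {e})) *
      (f S - f (symmDiff S {e})) ^ 2 = 4 * Fintype.card G.edgeSet *
        dirichletForm (transition G U W lam mu) (dist G U W lam mu) f := by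
  have h1 : ∀ X, ∑ Y, dist G U W lam mu X * transition G U W lam mu X Y * (f X - f Y) ^ 2 =
      ∑ e, 1 / (2 * (Fintype.card G.edgeSet : ℝ)) *
      (min (dist G U W lam mu X) (dist G U W lam mu (symmDiff X {e})) *
        (f X - f (symmDiff X {e})) ^ 2) := by
    intro X
    simp only [mul_assoc]
    rw [← Finset.mul_sum, sum_transition_mul G U W lam mu X (fun Y => (f X - f Y) ^ 2), sub_self,
      zero_pow two_ne_zero, mul_zero, add_zero, Finset.mul_sum]
    refine Finset.sum_congr rfl fun e _ => ?_
    rw [← mul_assoc, dist_mul_flipProb G U W hlam hmu, mul_assoc]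
  rw [dirichletForm, Finset.sum_comm]
  simp only [h1, ← Finset.mul_sum]
  rcases Nat.eq_zero_or_pos (Fintype.card G.edgeSet) with h0 | h0
  · have : IsEmpty G.edgeSet := Fintype.card_eq_zero_iff.1 h0
    simp
  · have : (Fintype.card G.edgeSet : ℝ) ≠ 0 := by positivity
    field_simp
    ring

end Chain

end RWS

/-! ### The mixing time on trees -/

namespace RWS

section Mixing

open scoped Classical

variable {V : Type*} [Fintype V] {G : SimpleGraph V}

/-- A tree has an order of its edges for which the vertices shared by an initial segment and its
complement number at most `log₂ |V|`. -/
lemma exists_edge_order (hG : G.IsTree) :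
    ∃ l : List G.edgeSet, l.Nodup ∧ (∀ e, e ∈ l) ∧ ∀ t, ∃ X : Finset V,
      2 ^ X.card ≤ Fintype.card V ∧ ∀ e ∈ (l.take t).toFinset, ∀ f ∉ (l.take t).toFinset,
        ∀ v, v ∈ (e : Sym2 V) → v ∈ (f : Sym2 V) → v ∈ X := by
  obtain ⟨r⟩ := hG.connected.nonempty
  obtain ⟨l, hl⟩ := hG.isAcyclic.exists_isNarrowOrder r
  have hmem : ∀ e ∈ l, e ∈ G.edgeSet := fun e he => ((hl.mem_iff e).1 he).1
  set l' := l.attachWith (· ∈ G.edgeSet) hmem with hl'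
  have htake : ∀ t (e : G.edgeSet), e ∈ l'.take t ↔ (e : Sym2 V) ∈ l.take t := by
    intro t e
    have : (l'.take t).map Subtype.val = l.take t := by
      rw [List.map_take, hl', List.attachWith_map_subtype_val]
    rw [← this, List.mem_map_of_injective Subtype.val_injective]
  refine ⟨l', ?_, fun e => ?_, fun t => ⟨SimpleGraph.frontier r (l.take t) (l.drop t), ?_, ?_⟩⟩
  · apply List.Nodup.of_map Subtype.val
    rw [hl', List.attachWith_map_subtype_val]
    exact hl.nodup
  · rw [hl', List.mem_attachWith, hl.mem_iff]
    exact ⟨e.2, fun v _ => hG.connected r v⟩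
  · refine (hl.card_le _ _ (List.take_append_drop t l).symm).trans ?_
    rw [← Nat.card_eq_fintype_card]
    exact Set.ncard_le_card _
  · intro e he f hf v hve hvf
    rw [List.mem_toFinset, htake] at he hf
    refine SimpleGraph.mem_frontier.2 ⟨⟨e, he, hve⟩, Or.inr ⟨f, ?_, hvf⟩⟩
    have : (f : Sym2 V) ∈ l := (hl.mem_iff f).2 ⟨f.2, fun v _ => hG.connected r v⟩
    rw [← List.take_append_drop t l, List.mem_append] at this
    exact this.resolve_left hf

lemma pow_le_rpow_mul_pow {lam : ℝ} (hlam : 0 < lam) {n k a b : ℕ} (hk : 2 ^ k ≤ n)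
    (hab : a ≤ b + k) (hba : b ≤ a + k) :
    lam ^ a ≤ (n : ℝ) ^ |Real.logb 2 lam| * lam ^ b := by
  have hpow : ∀ j : ℕ, lam ^ j = (2 : ℝ) ^ (Real.logb 2 lam * j) := by
    intro j
    rw [Real.rpow_mul (by norm_num), Real.rpow_logb (by norm_num) (by norm_num) hlam,
      Real.rpow_natCast]
  have hn : (2 : ℝ) ^ (|Real.logb 2 lam| * k) ≤ (n : ℝ) ^ |Real.logb 2 lam| := by
    rw [mul_comm, Real.rpow_mul (by norm_num), Real.rpow_natCast]
    exact Real.rpow_le_rpow (by positivity) (by exact_mod_cast hk) (abs_nonneg _)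
  rw [hpow, hpow]
  refine le_trans ?_ (mul_le_mul_of_nonneg_right hn (by positivity))
  rw [← Real.rpow_add (by norm_num)]
  refine Real.rpow_le_rpow_of_exponent_le (by norm_num) ?_
  have h1 : |(a : ℝ) - b| ≤ k := by
    rw [abs_le]
    have h1 : (a : ℝ) ≤ b + k := by exact_mod_cast hab
    have h2 : (b : ℝ) ≤ a + k := by exact_mod_cast hba
    constructor <;> linarith
  have h2 : Real.logb 2 lam * (a - b) ≤ |Real.logb 2 lam| * k := by
    refine (le_abs_self _).trans ?_
    rw [abs_mul]
    exact mul_le_mul_of_nonneg_left h1 (abs_nonneg _)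
  linarith

/-- Exchanging two edge sets on one side of a cut with `k` boundary vertices keeps the total number
of edges, and changes the total rank by at most `k`. -/
lemma dist_mul_dist_le_splice (hG : G.IsTree) {U W : Set V} (hUW : G.IsBipartiteWith U W)
    {lam mu : ℝ} (hlam : 0 < lam) (hmu : 0 < mu) {K : Finset G.edgeSet} {X : Finset V}
    (hcard : 2 ^ X.card ≤ Fintype.card V)
    (hX : ∀ e ∈ K, ∀ f ∉ K, ∀ v, v ∈ (e : Sym2 V) → v ∈ (f : Sym2 V) → v ∈ X)
    (I F : Finset G.edgeSet) :
    dist G U W lam mu I * dist G U W lam mu F ≤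
      (Fintype.card V : ℝ) ^ |Real.logb 2 lam| *
        (dist G U W lam mu (K.splice I F) * dist G U W lam mu (K.splice F I)) := by
  have h1 := rk₂_add_le_splice hG hUW hX I F
  have h2 := rk₂_add_le_splice hG hUW hX (K.splice I F) (K.splice F I)
  rw [Finset.splice_splice, Finset.splice_splice] at h2
  have h3 := pow_le_rpow_mul_pow hlam hcard h1 h2
  have h4 := K.card_splice_add I F
  simp only [dist]
  rw [div_mul_div_comm, div_mul_div_comm, mul_div_assoc']
  refine div_le_div_of_nonneg_right ?_
    (mul_self_nonneg (∑ T : Finset G.edgeSet, weight U W lam mu T))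
  simp only [weight]
  calc _ = lam ^ (rk₂ U W I + rk₂ U W F) * mu ^ (I.card + F.card) := by ring
    _ ≤ ((Fintype.card V : ℝ) ^ |Real.logb 2 lam| *
          lam ^ (rk₂ U W (K.splice I F) + rk₂ U W (K.splice F I))) * mu ^ (I.card + F.card) :=
        mul_le_mul_of_nonneg_right h3 (by positivity)
    _ = _ := by rw [← h4]; ring

lemma card_edgeSet_le (hG : G.IsTree) : Fintype.card G.edgeSet ≤ Fintype.card V := by
  rw [← hG.card_edgeFinset, SimpleGraph.edgeFinset_card]
  exact Nat.le_succ _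

lemma log_one_div_dist_le (hG : G.IsTree) (U W : Set V) {lam mu : ℝ} (hlam : 0 < lam)
    (hmu : 0 < mu) (S : Finset G.edgeSet) :
    Real.log (1 / dist G U W lam mu S) ≤
      Fintype.card V * (1 + |Real.log lam| + |Real.log mu|) := by
  set n := Fintype.card V
  have hm : (Fintype.card G.edgeSet : ℝ) ≤ n := by exact_mod_cast card_edgeSet_le hG
  have hw := weight_pos U W hlam hmu S
  set b : ℝ := n * (|Real.log lam| + |Real.log mu|) with hb
  have hdiff : ∀ {x y : ℕ} (c : ℝ), (x : ℝ) ≤ n → (y : ℝ) ≤ n →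
      x * c ≤ y * c + n * |c| := by
    intro x y c hx hy
    have h1 : |(x : ℝ) - y| ≤ n := by
      rw [abs_le]
      constructor <;> linarith [Nat.cast_nonneg (α := ℝ) x, Nat.cast_nonneg (α := ℝ) y]
    have h2 := le_abs_self (((x : ℝ) - y) * c)
    rw [abs_mul] at h2
    linarith [mul_le_mul_of_nonneg_right h1 (abs_nonneg c)]
  have hcard : ∀ T : Finset G.edgeSet, (T.card : ℝ) ≤ n := fun T =>
    le_trans (by exact_mod_cast Finset.card_le_univ T) hm
  have hle : ∀ T : Finset G.edgeSet, weight U W lam mu T ≤ weight U W lam mu S * Real.exp b := by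
    intro T
    have hT := weight_pos U W hlam hmu T
    rw [← Real.log_le_log_iff hT (by positivity), Real.log_mul hw.ne' (Real.exp_pos _).ne',
      Real.log_exp, weight, weight, Real.log_mul (by positivity) (by positivity),
      Real.log_mul (by positivity) (by positivity)]
    simp only [Real.log_pow]
    have h1 := hdiff (x := rk₂ U W T) (y := rk₂ U W S) (Real.log lam)
      (by exact_mod_cast rk₂_le_card U W T) (by exact_mod_cast rk₂_le_card U W S)
    have h2 := hdiff (Real.log mu) (hcard T) (hcard S)
    rw [hb]
    linarith
  have hZ : ∑ T : Finset G.edgeSet, weight U W lam mu T ≤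
      2 ^ Fintype.card G.edgeSet * (weight U W lam mu S * Real.exp b) := by
    refine (Finset.sum_le_sum fun T _ => hle T).trans ?_
    simp [Finset.card_univ]
  have hle2 : 1 / dist G U W lam mu S ≤ 2 ^ Fintype.card G.edgeSet * Real.exp b := by
    rw [dist, one_div_div, div_le_iff₀ hw]
    linarith
  have hd := dist_pos G U W hlam hmu S
  refine (Real.log_le_log (by positivity) hle2).trans ?_
  rw [Real.log_mul (by positivity) (Real.exp_pos _).ne', Real.log_exp, Real.log_pow, hb]
  have h1 := Real.log_two_lt_d9
  have h2 : (Fintype.card G.edgeSet : ℝ) * Real.log 2 ≤ Fintype.card G.edgeSet :=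
    mul_le_of_le_one_right (by positivity) (by linarith)
  linarith

/-- The bound on the mixing time before its additive constant is absorbed. -/
theorem exists_bondFlipMixingTime_eq (hG : G.IsTree) {U W : Set V} (hUW : G.IsBipartiteWith U W)
    {lam mu ε : ℝ} (hlam : 0 < lam) (hmu : 0 < mu) (hε : 0 < ε) (hε1 : ε < 1) :
    ∃ t : ℕ, bondFlipMixingTime G U W lam mu ε = t ∧
      (t : ℝ) ≤ (Fintype.card V : ℝ) ^ (3 + |Real.logb 2 lam|) *
        (5 + 8 * (|Real.log lam| + |Real.log mu| + Real.log (1 / ε))) := by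
  have := hG.connected.nonempty
  set n : ℝ := (Fintype.card V : ℝ) with hn
  set a := |Real.logb 2 lam| with ha
  have hn1 : 1 ≤ n := by
    rw [hn]; exact_mod_cast Fintype.card_pos (α := V)
  have ha0 : 0 ≤ a := abs_nonneg _
  have hna : 1 ≤ n ^ a := Real.one_le_rpow hn1 ha0
  have hm : (Fintype.card G.edgeSet : ℝ) ≤ n := by rw [hn]; exact_mod_cast card_edgeSet_le hG
  obtain ⟨l, hl, hmem, hcut⟩ := exists_edge_order hG
  have hchain := isLazyReversible G U W hlam hmu
  have hP : ∀ f : Finset G.edgeSet → ℝ, piVariance (dist G U W lam mu) f ≤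
      (4 * n ^ 2 * n ^ a) * dirichletForm (transition G U W lam mu) (dist G U W lam mu) f := by
    intro f
    have h1 := piVariance_le_of_splice (dist_pos G U W hlam hmu) (sum_dist G U W hlam hmu)
      (Λ := n ^ a) (by positivity) hl hmem (fun t I F => by
        obtain ⟨X, hX, hXcut⟩ := hcut t
        exact dist_mul_dist_le_splice hG hUW hlam hmu hX hXcut I F) f
    rw [dirichletForm_transition G U W hlam hmu] at h1
    have hE : 0 ≤ dirichletForm (transition G U W lam mu) (dist G U W lam mu) f :=
      mul_nonneg (by norm_num) (Finset.sum_nonneg fun x _ => Finset.sum_nonneg fun y _ =>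
        mul_nonneg (mul_nonneg (hchain.pos x).le (hchain.nonneg x y)) (sq_nonneg _))
    refine h1.trans ?_
    have hsq : (Fintype.card G.edgeSet : ℝ) ^ 2 ≤ n ^ 2 := pow_le_pow_left₀ (by positivity) hm 2
    calc _ = (4 * (Fintype.card G.edgeSet : ℝ) ^ 2 * n ^ a) *
          dirichletForm (transition G U W lam mu) (dist G U W lam mu) f := by ring
      _ ≤ _ := by gcongr
  have hρ : 1 ≤ 4 * n ^ 2 * n ^ a := by nlinarith [one_le_pow₀ hn1 (n := 2)]
  obtain ⟨t, ht, hle⟩ := hchain.exists_mixingTime_eq hρ hP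
    (fun S => log_one_div_dist_le hG U W hlam hmu S) (by positivity) hε hε1
  refine ⟨t, ht, hle.trans ?_⟩
  have h3 : n ^ (3 + a) = n ^ 3 * n ^ a := by
    rw [Real.rpow_add (by linarith)]
    norm_cast
  have hlog : 0 ≤ Real.log (1 / ε) := Real.log_nonneg (by rw [le_div_iff₀ hε]; linarith)
  have hn3 : 1 ≤ n ^ 3 * n ^ a := one_le_mul_of_one_le_of_one_le (one_le_pow₀ hn1) hna
  rw [h3]
  set A := |Real.log lam| + |Real.log mu| with hA
  have hA0 : 0 ≤ A := by positivity
  calc 4 * n ^ 2 * n ^ a * (n * (1 + |Real.log lam| + |Real.log mu|) + 2 * Real.log (1 / ε)) + 1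
      ≤ 4 * n ^ 2 * n ^ a * (n * (1 + A) + n * (2 * Real.log (1 / ε))) + n ^ 3 * n ^ a := by
        have : n * (1 + |Real.log lam| + |Real.log mu|) = n * (1 + A) := by rw [hA]; ring
        rw [this]
        have h2 : 2 * Real.log (1 / ε) ≤ n * (2 * Real.log (1 / ε)) :=
          le_mul_of_one_le_left (by positivity) hn1
        gcongr
    _ = n ^ 3 * n ^ a * (5 + 4 * A + 8 * Real.log (1 / ε)) := by ring
    _ ≤ _ := mul_le_mul_of_nonneg_left (by linarith) (by linarith)

end Mixing

end RWS

theorem theorem3 :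
    (∀ ε₀ : ℝ, 0 < ε₀ → ε₀ < 1 → ∃ C : ℝ, 0 < C ∧
      ∀ lam mu : ℝ, 0 < lam → 0 < mu →
      ∀ (V : Type*) [Fintype V] (G : SimpleGraph V), G.IsTree →
      ∀ U W : Set V, G.IsBipartiteWith U W →
      ∀ ε : ℝ, 0 < ε → ε ≤ ε₀ →
        ∃ t : ℕ, RWS.bondFlipMixingTime G U W lam mu ε = (t : ℕ∞) ∧
          (t : ℝ) ≤ C * ((Fintype.card V : ℝ) ^ (3 + |Real.logb 2 lam|) *
            (|Real.log lam| + |Real.log mu| + Real.log (1 / ε)))) ∧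
    (∀ lam mu : ℝ, 0 < lam → 0 < mu → (lam ≠ 1 ∨ mu ≠ 1) → ∃ C : ℝ, 0 < C ∧
      ∀ (V : Type*) [Fintype V] (G : SimpleGraph V), G.IsTree →
      ∀ U W : Set V, G.IsBipartiteWith U W →
      ∀ ε : ℝ, 0 < ε → ε < 1 →
        ∃ t : ℕ, RWS.bondFlipMixingTime G U W lam mu ε = (t : ℕ∞) ∧
          (t : ℝ) ≤ C * ((Fintype.card V : ℝ) ^ (3 + |Real.logb 2 lam|) *
            (|Real.log lam| + |Real.log mu| + Real.log (1 / ε)))) := by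
  -- Where the sum of logarithms is at least `δ`, it absorbs additive constants.
  have absorb : ∀ {δ s N : ℝ}, 0 < δ → δ ≤ s → 0 ≤ N →
      N * (5 + 8 * s) ≤ (5 / δ + 8) * (N * s) := by
    intro δ s N hδ hs hN
    have h1 : 5 ≤ 5 / δ * s := by
      rw [div_mul_eq_mul_div, le_div_iff₀ hδ]; linarith
    calc N * (5 + 8 * s) ≤ N * (5 / δ * s + 8 * s) := by gcongr
      _ = _ := by ring
  constructor
  · intro ε₀ h0 h1
    have hδ : 0 < Real.log (1 / ε₀) := Real.log_pos (by rw [lt_div_iff₀ h0]; linarith)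
    refine ⟨5 / Real.log (1 / ε₀) + 8, by positivity, ?_⟩
    intro lam mu hlam hmu V _ G hG U W hUW ε hε hεε₀
    obtain ⟨t, ht, hle⟩ := RWS.exists_bondFlipMixingTime_eq hG hUW hlam hmu hε (by linarith)
    refine ⟨t, ht, hle.trans (absorb hδ ?_ (by positivity))⟩
    have : Real.log (1 / ε₀) ≤ Real.log (1 / ε) :=
      Real.log_le_log (by positivity) (one_div_le_one_div_of_le hε hεε₀)
    linarith [abs_nonneg (Real.log lam), abs_nonneg (Real.log mu)]
  · intro lam mu hlam hmu hne
    have hδ : 0 < |Real.log lam| + |Real.log mu| := by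
      rcases hne with h | h
      · have := abs_pos.2 (Real.log_ne_zero_of_pos_of_ne_one hlam h)
        positivity
      · have := abs_pos.2 (Real.log_ne_zero_of_pos_of_ne_one hmu h)
        positivity
    refine ⟨5 / (|Real.log lam| + |Real.log mu|) + 8, by positivity, ?_⟩
    intro V _ G hG U W hUW ε hε hε1
    obtain ⟨t, ht, hle⟩ := RWS.exists_bondFlipMixingTime_eq hG hUW hlam hmu hε hε1
    refine ⟨t, ht, hle.trans (absorb hδ ?_ (by positivity))⟩
    have : 0 ≤ Real.log (1 / ε) := Real.log_nonneg (by rw [le_div_iff₀ hε]; linarith)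
    linarith
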